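/- **Proposition 5.1.** Let $X$ be a metric space, let $Y$ be a compactly generated space, meaning that a subset $A\subseteq Y$ is closed if and only if $A\cap K$ is closed in $K$ for every compact $K\subseteq Y$ (in particular, $Y$ may be any convenient space in the sense of Steenrod, i.e. a compactly generated Hausdorff space), and let $f:X\to Y$ be a continuous map that is proper, i.e. $f^{-1}(K)$ is compact for every compact $K\subseteq Y$. Then the analog sectional category and the distributional sectional category of $f$ are equal. Here $\mathcal P(X)$ is the set of probability measures on $X$ with finite support, and $\mathcal P_n(f)\subseteq\mathcal P(X)$ is the set of those measures whose support has at most $n$ points and is contained in a single fiber of $f$. There is a map $\mathcal P_n(f)\to Y$ sending a measure to the point in whose fiber it is supported. The *analog sectional category* of $f$ is the least integer $n\ge 0$ for which $\mathcal P_{n+1}(f)\to Y$ has a continuous section (and $\infty$ if there is no such $n$), where $\mathcal P_{n+1}(f)$ carries the subspace topology from $\mathcal P(X)$, and $\mathcal P(X)$ carries the quotient topology from the maps $$X^m\times\Delta^{m-1}\to\mathcal P(X),\qquad (x,t)\mapsto\sum_{i=1}^m t_i\delta_{x_i}\qquad(m\ge 0),$$ with $\Delta^{m-1}=\{t\in[0,1]^m:\sum_i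 t_i=1\}$. The *distributional sectional category* of $f$ is defined in the same way, with the topology of the Lévy–Prokhorov metric on $\mathcal P(X)$ in place of the quotient topology. -/

import Mathlib

open MeasureTheory Set

noncomputable section

namespace SectionalCategory

section Measures

variable {X : Type*} [MeasurableSpace X]

/-- The set of atoms of a probability measure. For a measure concentrated on a finite set, on a
space with measurable points, this is its support. -/
def supp (μ : ProbabilityMeasure X) : Set X := {x | (μ : Measure X) {x} ≠ 0}

/-- A probability measure has finite support if it is concentrated on a finite set. -/
def HasFiniteSupport (μ : ProbabilityMeasure X) : Prop :=
  ∃ s : Finset X, (μ : Measure X) (s : Set X)ᶜ = 0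

lemma supp_nonempty {μ : ProbabilityMeasure X} (h : HasFiniteSupport μ) : (supp μ).Nonempty := by
  obtain ⟨s, hs⟩ := h
  by_contra hne
  have h0 : ∀ x, (μ : Measure X) {x} = 0 := by
    intro x
    by_contra hx
    exact hne ⟨x, hx⟩
  have h1 : (μ : Measure X) (s : Set X) = 0 := by
    rw [← Set.biUnion_of_singleton (s : Set X)]
    exact (measure_biUnion_null_iff s.countable_toSet).2 fun x _ => h0 x
  have h2 : (μ : Measure X) univ ≤ 0 := by
    rw [← Set.union_compl_self (s : Set X)]
    exact (measure_union_le _ _).trans (by simp [h1, hs])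
  simp at h2

variable (X) in
/-- `P X`: the set of probability measures with finite support on `X`. -/
@[ext] structure P where
  /-- The underlying measure. -/
  measure : ProbabilityMeasure X
  hasFiniteSupport : HasFiniteSupport measure

/-- The probability measure `∑ i, t i • δ_{x i}`. -/
def convexCombination {n : ℕ} (x : Fin n → X) (t : stdSimplex ℝ (Fin n)) : ProbabilityMeasure X :=
  ⟨∑ i, ENNReal.ofReal (t.1 i) • Measure.dirac (x i), ⟨by
    simp only [Measure.coe_finsetSum, Finset.sum_apply, Measure.smul_apply, measure_univ,
      smul_eq_mul, mul_one]
    rw [← ENNReal.ofReal_sum_of_nonneg fun i _ => t.2.1 i, t.2.2, ENNReal.ofReal_one]⟩⟩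

lemma hasFiniteSupport_convexCombination [MeasurableSingletonClass X] {n : ℕ} (x : Fin n → X)
    (t : stdSimplex ℝ (Fin n)) : HasFiniteSupport (convexCombination x t) := by
  classical
  refine ⟨Finset.univ.image x, ?_⟩
  simp only [convexCombination, ProbabilityMeasure.coe_mk, Measure.coe_finsetSum,
    Finset.sum_apply, Measure.smul_apply, smul_eq_mul]
  refine Finset.sum_eq_zero fun i _ => ?_
  rw [Measure.dirac_apply' _ (Finset.measurableSet _).compl]
  simp

/-- The map `X ^ n × Δ ^ (n - 1) → P X` sending `(x, t)` to `∑ i, t i • δ_{x i}`. -/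
def mixture [MeasurableSingletonClass X] (n : ℕ) (p : (Fin n → X) × stdSimplex ℝ (Fin n)) : P X :=
  ⟨convexCombination p.1 p.2, hasFiniteSupport_convexCombination p.1 p.2⟩

variable (X) in
/-- The quotient topology on `P X`: the finest topology for which all the maps
`X ^ n × Δ ^ (n - 1) → P X` are continuous. (Supremum in Mathlib's order on topologies: a set is
open if and only if its preimages under all these maps are open.) -/
@[reducible] def quotientTopology [TopologicalSpace X] [MeasurableSingletonClass X] : TopologicalSpace (P X) :=
  ⨆ n : ℕ, TopologicalSpace.coinduced (mixture n) inferInstance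

variable (X) in
/-- The topology on `P X` of the Lévy–Prokhorov metric. -/
@[reducible] def levyProkhorovTopology [MetricSpace X] [BorelSpace X] : TopologicalSpace (P X) :=
  TopologicalSpace.induced
    (fun μ => (LevyProkhorov.ofMeasure μ.measure : LevyProkhorov (ProbabilityMeasure X))) inferInstance

end Measures

section Fiberwise

variable {X Y : Type*} [MeasurableSpace X]

/-- `PFib n f`: the set of finitely supported probability measures on `X` whose support has at most
`n` points and lies in a single fiber of `f`. -/
@[ext] structure PFib (n : ℕ) (f : X → Y) where
  /-- The underlying element of `P X`. -/
  val : P X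
  encard_supp_le : (supp val.measure).encard ≤ n
  eq_of_mem_supp : ∀ x ∈ supp val.measure, ∀ x' ∈ supp val.measure, f x = f x'

/-- The projection `PFib n f → Y`, sending a measure to the point in whose fiber it is
supported. -/
def proj {n : ℕ} {f : X → Y} (μ : PFib n f) : Y := f (supp_nonempty μ.val.hasFiniteSupport).some

lemma proj_eq {n : ℕ} {f : X → Y} (μ : PFib n f) {x : X} (hx : x ∈ supp μ.val.measure) :
    proj μ = f x :=
  μ.eq_of_mem_supp _ (supp_nonempty μ.val.hasFiniteSupport).some_mem x hx

/-- Given a topology `t` on `P X`, the map `PFib n f → Y` has a continuous section, where `PFib n f`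
carries the subspace topology. -/
def HasSection [TopologicalSpace Y] (t : TopologicalSpace (P X)) (n : ℕ) (f : X → Y) : Prop :=
  ∃ σ : Y → PFib n f,
    (@Continuous Y (PFib n f) _ (TopologicalSpace.induced PFib.val t) σ) ∧
      ∀ y, proj (σ y) = y

/-- The least `n` for which `PFib (n + 1) f → Y` has a continuous section, and `⊤` if there is no
such `n`. -/
def sectionalCategory [TopologicalSpace Y] (t : TopologicalSpace (P X)) (f : X → Y) : ℕ∞ :=
  ⨅ (n : ℕ) (_ : HasSection t (n + 1) f), (n : ℕ∞)

/-- The analog sectional category: quotient topology on spaces of measures. -/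
def analogSecat [TopologicalSpace X] [MeasurableSingletonClass X] [TopologicalSpace Y]
    (f : X → Y) : ℕ∞ :=
  sectionalCategory (quotientTopology X) f

/-- The distributional sectional category: Lévy–Prokhorov topology on spaces of measures. -/
def distributionalSecat [MetricSpace X] [BorelSpace X] [TopologicalSpace Y] (f : X → Y) : ℕ∞ :=
  sectionalCategory (levyProkhorovTopology X) f

end Fiberwise

end SectionalCategory

end

/-!
The two sectional categories agree because, for each `n`, a section of `PFib n f → Y` is continuous
for the quotient topology if and only if it is continuous for the Lévy–Prokhorov topology.

The quotient topology is the finer one: the map sending `(x, t)` to `∑ i, t i • δ_{x i}` is continuous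
for the Lévy–Prokhorov metric, by the estimate `dist_ofMeasure_convexCombination_le`.

Conversely, continuity on the compactly generated space `Y` may be tested on compact sets `K`. Over
`K`, a section takes values in the measures with at most `n` atoms, all of them in the compact set
`C = f ⁻¹' K`. These measures form the image of the compact space `C ^ n × Δ ^ (n - 1)`
(`exists_mixture_eq`). A continuous map from a compact space to a Hausdorff space is closed, so on
this image the Lévy–Prokhorov topology is as fine as the quotient topology
(`isClosed_image_mixture`), and the section is continuous for the latter as well.
-/

open Filter Topology

namespace SectionalCategory

section MeasureLemmas

variable {X : Type*} [MeasurableSpace X]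

lemma convexCombination_apply {n : ℕ} (x : Fin n → X) (t : stdSimplex ℝ (Fin n)) (B : Set X) :
    (convexCombination x t : Measure X) B =
      ∑ i, ENNReal.ofReal (t.1 i) * Measure.dirac (x i) B := by
  simp [convexCombination]

lemma measure_compl_supp {μ : ProbabilityMeasure X} (h : HasFiniteSupport μ) :
    (μ : Measure X) (supp μ)ᶜ = 0 := by
  obtain ⟨s, hs⟩ := h
  refine measure_mono_null (t := (s : Set X)ᶜ ∪ ⋃ x ∈ (s : Set X) \ supp μ, {x}) ?_
    (measure_union_null hs ((measure_biUnion_null_iff (s.countable_toSet.mono sdiff_subset)).2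
      fun x hx => not_not.1 hx.2))
  intro x hx
  by_cases hxs : x ∈ (s : Set X)
  · exact .inr (mem_biUnion (⟨hxs, hx⟩ : x ∈ (s : Set X) \ supp μ) rfl)
  · exact .inl hxs

lemma apply_eq_sum_supp [MeasurableSingletonClass X] {μ : ProbabilityMeasure X}
    (h : HasFiniteSupport μ) [Fintype (supp μ)] {B : Set X} (hB : MeasurableSet B) :
    (μ : Measure X) B = ∑ a : supp μ, (μ : Measure X) {a.1} * Measure.dirac a.1 B := by
  have hB' : (μ : Measure X) B = (μ : Measure X) (⋃ a : supp μ, {a.1} ∩ B) := by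
    rw [← iUnion_inter, iUnion_of_singleton_coe, inter_comm]
    exact (measure_inter_conull (measure_compl_supp h)).symm
  rw [hB', measure_iUnion, tsum_fintype]
  · refine Finset.sum_congr rfl fun a _ => ?_
    by_cases ha : a.1 ∈ B
    · simp [ha]
    · simp [Measure.dirac_apply' _ hB, ha]
  · intro a b hab
    exact (disjoint_singleton.2 (Subtype.coe_injective.ne hab)).mono inter_subset_left
      inter_subset_left
  · exact fun a => (measurableSet_singleton _).inter hB

/-- A finitely supported probability measure with at most `n` atoms is a convex combination of `n`
Dirac masses at atoms. If there are fewer than `n` atoms, the list of atoms is filled up with copies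
of one of them, with weight zero. -/
lemma exists_mixture_eq [MeasurableSingletonClass X] {n : ℕ} (μ : P X)
    (hn : (supp μ.measure).encard ≤ n) :
    ∃ p : (Fin n → X) × stdSimplex ℝ (Fin n),
      (∀ i, p.1 i ∈ supp μ.measure) ∧ mixture n p = μ := by
  obtain ⟨hfin, hcard⟩ := Set.encard_le_coe_iff_finite_ncard_le.1 hn
  have : Fintype (supp μ.measure) := hfin.fintype
  obtain ⟨x₀, hx₀⟩ := supp_nonempty μ.hasFiniteSupport
  obtain ⟨e⟩ : Nonempty (supp μ.measure ↪ Fin n) :=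
    Function.Embedding.nonempty_of_card_le (by
      rwa [Fintype.card_fin, ← Nat.card_eq_fintype_card, Nat.card_coe_set_eq])
  set x : Fin n → X := Function.extend e Subtype.val fun _ => x₀ with hx
  set t : Fin n → ℝ :=
    Function.extend e (fun a => ((μ.measure : Measure X) {a.1}).toReal) 0
  have hxe : ∀ a, x (e a) = a.1 := e.injective.extend_apply _ _
  have hte : ∀ a, t (e a) = ((μ.measure : Measure X) {a.1}).toReal := e.injective.extend_apply _ _
  have ht0 : ∀ i ∉ range e, t i = 0 := fun i hi =>
    Function.extend_apply' _ _ _ hi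
  have hsupp : ∀ i, x i ∈ supp μ.measure := by
    intro i
    by_cases hi : i ∈ range e
    · obtain ⟨a, rfl⟩ := hi
      rw [hxe]
      exact a.2
    · rwa [hx, Function.extend_apply' _ _ _ hi]
  have htnonneg : ∀ i, 0 ≤ t i := by
    intro i
    by_cases hi : i ∈ range e
    · obtain ⟨a, rfl⟩ := hi
      rw [hte]
      exact ENNReal.toReal_nonneg
    · exact (ht0 i hi).ge
  have htsum : ∑ i, t i = 1 := by
    rw [← Fintype.sum_of_injective e e.injective
      (fun a : supp μ.measure => ((μ.measure : Measure X) {a.1}).toReal) t ht0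
      fun a => (hte a).symm, ← ENNReal.toReal_sum fun _ _ => measure_ne_top _ _]
    have h1 := apply_eq_sum_supp μ.hasFiniteSupport MeasurableSet.univ
    simp only [measure_univ, mul_one] at h1
    rw [← h1, ENNReal.toReal_one]
  refine ⟨(x, ⟨t, htnonneg, htsum⟩), hsupp, ?_⟩
  ext B hB
  change (convexCombination x ⟨t, htnonneg, htsum⟩ : Measure X) B = _
  rw [convexCombination_apply, apply_eq_sum_supp μ.hasFiniteSupport hB]
  refine (Fintype.sum_of_injective e e.injective _ _ (fun i hi => ?_) fun a => ?_).symm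
  · simp [ht0 i hi]
  · simp [hxe, hte]

end MeasureLemmas

section Topologies

variable {X : Type*} [MetricSpace X] [MeasurableSpace X] [BorelSpace X]

/-- Moving the points by at most `dist x y` and redistributing the mass `∑ i, |t i - s i|` changes
a convex combination of Dirac masses by at most the sum of these in the Lévy–Prokhorov metric. -/
lemma dist_ofMeasure_convexCombination_le {n : ℕ} (x y : Fin n → X)
    (t s : stdSimplex ℝ (Fin n)) :
    dist (LevyProkhorov.ofMeasure (convexCombination x t))
      (LevyProkhorov.ofMeasure (convexCombination y s)) ≤ dist x y + ∑ i, |t.1 i - s.1 i| := by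
  have hsum : 0 ≤ ∑ i, |t.1 i - s.1 i| := Finset.sum_nonneg fun _ _ => abs_nonneg _
  rw [LevyProkhorov.dist_probabilityMeasure_def]
  refine levyProkhorovDist_le_of_forall_le _ _ (add_nonneg dist_nonneg hsum) fun ε B hε hB => ?_
  have hmass : ∑ i, ENNReal.ofReal |t.1 i - s.1 i| ≤ ENNReal.ofReal ε := by
    rw [← ENNReal.ofReal_sum_of_nonneg fun _ _ => abs_nonneg _]
    exact ENNReal.ofReal_le_ofReal (by linarith [dist_nonneg (x := x) (y := y)])
  change (convexCombination x t : Measure X) B ≤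
    (convexCombination y s : Measure X) (Metric.thickening ε B) + _
  rw [convexCombination_apply, convexCombination_apply]
  refine le_trans ?_ (add_le_add le_rfl hmass)
  rw [← Finset.sum_add_distrib]
  refine Finset.sum_le_sum fun i _ => ?_
  by_cases hi : x i ∈ B
  · have hy : y i ∈ Metric.thickening ε B :=
      Metric.mem_thickening_iff.2 ⟨x i, hi, by
        rw [dist_comm]
        linarith [dist_le_pi_dist x y i]⟩
    rw [Measure.dirac_apply_of_mem hi, Measure.dirac_apply_of_mem hy, mul_one, mul_one]
    refine (ENNReal.ofReal_le_ofReal ?_).trans ENNReal.ofReal_add_le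
    linarith [le_abs_self (t.1 i - s.1 i)]
  · simp [Measure.dirac_apply' _ hB, hi]

lemma continuous_ofMeasure_mixture (n : ℕ) :
    Continuous fun p : (Fin n → X) × stdSimplex ℝ (Fin n) =>
      (LevyProkhorov.ofMeasure (mixture n p).measure : LevyProkhorov (ProbabilityMeasure X)) := by
  refine continuous_iff_continuousAt.2 fun p => tendsto_iff_dist_tendsto_zero.2 ?_
  refine squeeze_zero (fun _ => dist_nonneg)
    (fun q => dist_ofMeasure_convexCombination_le q.1 p.1 q.2 p.2) ?_
  refine Continuous.tendsto' ?_ _ _ (by simp)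
  have h : ∀ i, Continuous fun q : (Fin n → X) × stdSimplex ℝ (Fin n) => q.2.1 i :=
    fun i => (continuous_apply i).comp (continuous_subtype_val.comp continuous_snd)
  exact (continuous_fst.dist continuous_const).add
    (continuous_finsetSum _ fun i _ => ((h i).sub continuous_const).abs)

lemma continuous_mixture_levyProkhorov (n : ℕ) :
    Continuous[inferInstance, levyProkhorovTopology X] (mixture (X := X) n) :=
  continuous_induced_rng.2 (continuous_ofMeasure_mixture n)

variable (X) in
lemma quotientTopology_le_levyProkhorovTopology :
    quotientTopology X ≤ levyProkhorovTopology X :=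
  iSup_le fun n => continuous_iff_coinduced_le.1 (continuous_mixture_levyProkhorov n)

variable (X) in
lemma t2Space_levyProkhorovTopology : @T2Space (P X) (levyProkhorovTopology X) := by
  let _ : TopologicalSpace (P X) := levyProkhorovTopology X
  refine T2Space.of_injective_continuous
    (f := fun μ : P X => (LevyProkhorov.ofMeasure μ.measure : LevyProkhorov (ProbabilityMeasure X)))
    (fun μ ν h => P.ext ?_) continuous_induced_dom
  exact congrArg LevyProkhorov.toMeasure h

/-- A set `G` that is closed for the quotient topology meets the measures with at most `n` atoms, all
of them in a compact set `C`, in a set that is closed for the Lévy–Prokhorov topology: the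
intersection is the image of a closed subset of the compact space `C ^ n × Δ ^ (n - 1)`. -/
lemma isClosed_image_mixture {n : ℕ} {C : Set X} (hC : IsCompact C) {G : Set (P X)}
    (hG : IsClosed[quotientTopology X] G) :
    IsClosed[levyProkhorovTopology X]
      (mixture n '' ({p | ∀ i, p.1 i ∈ C} ∩ mixture n ⁻¹' G)) := by
  have hpre : IsClosed (mixture (X := X) n ⁻¹' G) :=
    isClosed_coinduced.1 (hG.mono (le_iSup
      (fun n => TopologicalSpace.coinduced (mixture (X := X) n) inferInstance) n))
  have hcomp : IsCompact {p : (Fin n → X) × stdSimplex ℝ (Fin n) | ∀ i, p.1 i ∈ C} := by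
    convert! (isCompact_univ_pi fun _ : Fin n => hC).prod
      (isCompact_univ (X := stdSimplex ℝ (Fin n))) using 1
    ext p
    simp
  let _ : TopologicalSpace (P X) := levyProkhorovTopology X
  have := t2Space_levyProkhorovTopology X
  exact ((hcomp.inter_right hpre).image (continuous_mixture_levyProkhorov n)).isClosed

end Topologies

section Sections

variable {X Y : Type*} [MeasurableSpace X] [TopologicalSpace Y]

lemma HasSection.mono {t t' : TopologicalSpace (P X)} (h : t ≤ t') {n : ℕ} {f : X → Y}
    (hs : HasSection t n f) : HasSection t' n f := by
  obtain ⟨σ, hσ, hproj⟩ := hs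
  exact ⟨σ, continuous_le_rng (induced_mono h) hσ, hproj⟩

variable [MetricSpace X] [BorelSpace X]

/-- Over a compact set `K`, a section takes its values in the measures carried by the compact set
`f ⁻¹' K`, where closedness in the quotient topology passes to the Lévy–Prokhorov topology. -/
lemma continuous_section_quotientTopology [CompactlyCoherentSpace Y] {f : X → Y}
    (hproper : ∀ K : Set Y, IsCompact K → IsCompact (f ⁻¹' K)) {n : ℕ} {σ : Y → PFib n f}
    (hσ : Continuous[_, levyProkhorovTopology X] fun y => (σ y).val)
    (hproj : ∀ y, proj (σ y) = y) :
    Continuous[_, quotientTopology X] fun y => (σ y).val := by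
  refine (@continuous_iff_isClosed Y (P X) _ (quotientTopology X) _).2 fun G hG => ?_
  refine (CompactlyCoherentSpace.isClosed_iff _).2 fun K hK => ?_
  have hclosed := @IsClosed.preimage Y (P X) _ (levyProkhorovTopology X) _ hσ _
    (isClosed_image_mixture (n := n) (hproper K hK) hG)
  convert! hclosed.preimage (continuous_subtype_val (p := (· ∈ K))) using 1
  ext ⟨y, hy⟩
  constructor
  · intro hyG
    obtain ⟨p, hp, hpy⟩ := exists_mixture_eq (σ y).val (σ y).encard_supp_le
    refine ⟨p, ⟨fun i => ?_, ?_⟩, hpy⟩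
    · rw [mem_preimage, ← proj_eq (σ y) (hp i), hproj]
      exact hy
    · rw [mem_preimage, hpy]
      exact hyG
  · rintro ⟨p, hp, hpy⟩
    change (σ y).val ∈ G
    exact (show mixture n p = (σ y).val from hpy) ▸ hp.2

lemma hasSection_quotientTopology_iff [CompactlyCoherentSpace Y] {f : X → Y}
    (hproper : ∀ K : Set Y, IsCompact K → IsCompact (f ⁻¹' K)) (n : ℕ) :
    HasSection (quotientTopology X) n f ↔ HasSection (levyProkhorovTopology X) n f := by
  refine ⟨.mono (quotientTopology_le_levyProkhorovTopology X), fun ⟨σ, hσ, hproj⟩ =>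
    ⟨σ, continuous_induced_rng.2 ?_, hproj⟩⟩
  exact continuous_section_quotientTopology hproper (continuous_induced_rng.1 hσ) hproj

end Sections

end SectionalCategory

theorem proposition5p1 {X : Type*} [MetricSpace X] [MeasurableSpace X] [BorelSpace X]
    {Y : Type*} [TopologicalSpace Y] [CompactlyCoherentSpace Y]
    (f : X → Y) (hf : Continuous f) (hproper : ∀ K : Set Y, IsCompact K → IsCompact (f ⁻¹' K)) :
    SectionalCategory.analogSecat f = SectionalCategory.distributionalSecat f := by
  simp only [SectionalCategory.analogSecat, SectionalCategory.distributionalSecat,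
    SectionalCategory.sectionalCategory,
    SectionalCategory.hasSection_quotientTopology_iff hproper]
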